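/- Let $\mathcal{E}=\{\leftarrow,\rightarrow,\uparrow,\downarrow\}$ be the set of the four unit vectors of $\mathbb{Z}^2$, let $\mu$ be a probability measure on the power set of $\mathcal{E}$, and let $\mathcal{G}=(\mathcal{G}_x)_{x\in\mathbb{Z}^2}$ be i.i.d. random subsets of $\mathcal{E}$ with law $\mu$; denote their joint (product) law by $\mathbb{P}$. Write $x\to y$ if for some $n\ge 0$ there are $x=x_0,x_1,\dots,x_n=y$ with $x_{i+1}-x_i\in\mathcal{G}_{x_i}$ for $0\le i<n$. Let $\mathcal{C}_x=\{y\in\mathbb{Z}^2: x\to y\}$, and let $\bar{\mathcal{C}}_x$ be the set of all $z\in\mathbb{Z}^2$ such that every infinite nearest-neighbour self-avoiding path in $\mathbb{Z}^2$ started at $z$ passes through $\mathcal{C}_x$. For $w:\mathbb{Z}\to\mathbb{Z}$ put $w_{\ge}=\{(a,b)\in\mathbb{Z}^2: b\ge w(a)\}$, and define $w_{\le}$, $w_{>}$, $w_{<}$ similarly. Call $w$ a forward lower blocking function if there are no $y\in w_{\ge}$ and $z\in w_{<}$ with $y\to z$, and a forward upper blocking function if there are no $y\in w_{\le}$ and $z\in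 w_{>}$ with $y\to z$. "Decreasing" means non-increasing. For $V\subseteq\mathcal{E}$ let $\mathcal{A}_V=\{E\subseteq\mathcal{E}: E\cap V\neq\varnothing\}$. Assume that $\mu(\mathcal{A}_{\{\leftarrow,\uparrow\}})=1$, $\mu(\mathcal{A}_{\{\rightarrow,\downarrow\}})=1$, and $\mu(\mathcal{A}_{\{e\}})>0$ for each $e\in\mathcal{E}$. Then: (a) For every $x\in\mathbb{Z}^2$, $\mathbb{P}$-almost surely at least one of the following holds: (i) $\bar{\mathcal{C}}_x=\mathbb{Z}^2$; (ii) there is a decreasing forward lower blocking function $W:\mathbb{Z}\to\mathbb{Z}$ with $\bar{\mathcal{C}}_x=W_{\ge}$; (iii) there is a decreasing forward upper blocking function $W:\mathbb{Z}\to\mathbb{Z}$ with $\bar{\mathcal{C}}_x=W_{\le}$. (b) Exactly one of the cases (i), (ii), (iii) has non-zero probability, and this case is the same for all $x\in\mathbb{Z}^2$. -/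

import Mathlib

open MeasureTheory

namespace DRE

/-- The four nearest-neighbour directions of the square lattice. -/
inductive Dir where
  | left
  | right
  | up
  | down

/-- The unit vector of `ℤ²` associated with a direction. -/
def Dir.vec : Dir → ℤ × ℤ
  | .left => (-1, 0)
  | .right => (1, 0)
  | .up => (0, 1)
  | .down => (0, -1)

/-- An environment: to each site of `ℤ²` a set of allowed directions. -/
abbrev Env : Type := ℤ × ℤ → Set Dir

/-- The product law under which the local environments are i.i.d. with law `μ`. -/
noncomputable def law (μ : Measure (Set Dir)) [IsProbabilityMeasure μ] : Measure Env :=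
  Measure.infinitePi (fun _ : ℤ × ℤ => μ)

/-- The local environments which contain at least one direction of `V`. -/
def meets (V : Set Dir) : Set (Set Dir) := {E | (E ∩ V).Nonempty}

/-- `y` is reached from `x` by one directed edge of `G`. -/
def Step (G : Env) (x y : ℤ × ℤ) : Prop := ∃ e ∈ G x, y = x + e.vec

/-- `x → y`: there is a finite open path in `G`, possibly of length zero, from `x` to `y`. -/
def Connected (G : Env) : ℤ × ℤ → ℤ × ℤ → Prop := Relation.ReflTransGen (Step G)

/-- The forward cluster of `x`. -/
def fwdCluster (G : Env) (x : ℤ × ℤ) : Set (ℤ × ℤ) := {y | Connected G x y}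

/-- `γ` is an infinite nearest-neighbour self-avoiding path in `ℤ²`, not necessarily open. -/
def IsSelfAvoidingPath (γ : ℕ → ℤ × ℤ) : Prop :=
  (∀ n, ∃ e : Dir, γ (n + 1) = γ n + e.vec) ∧ Function.Injective γ

/-- The filled forward cluster of `x`: the sites `z` such that every infinite nearest-neighbour
self-avoiding path started at `z` passes through the forward cluster of `x`. -/
def filledCluster (G : Env) (x : ℤ × ℤ) : Set (ℤ × ℤ) :=
  {z | ∀ γ : ℕ → ℤ × ℤ, IsSelfAvoidingPath γ → γ 0 = z → ∃ n, γ n ∈ fwdCluster G x}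

/-- The sites above `w`. -/
def setGE (w : ℤ → ℤ) : Set (ℤ × ℤ) := {y | w y.1 ≤ y.2}

/-- The sites below `w`. -/
def setLE (w : ℤ → ℤ) : Set (ℤ × ℤ) := {y | y.2 ≤ w y.1}

/-- The sites strictly above `w`. -/
def setGT (w : ℤ → ℤ) : Set (ℤ × ℤ) := {y | w y.1 < y.2}

/-- The sites strictly below `w`. -/
def setLT (w : ℤ → ℤ) : Set (ℤ × ℤ) := {y | y.2 < w y.1}

/-- `w` is a forward lower blocking function for `G`. -/
def IsFLBF (G : Env) (w : ℤ → ℤ) : Prop :=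
  ∀ y ∈ setGE w, ∀ z ∈ setLT w, ¬ Connected G y z

/-- `w` is a forward upper blocking function for `G`. -/
def IsFUBF (G : Env) (w : ℤ → ℤ) : Prop :=
  ∀ y ∈ setLE w, ∀ z ∈ setGT w, ¬ Connected G y z

/-- The filled forward cluster of `x` is the whole lattice. -/
def IsFull (G : Env) (x : ℤ × ℤ) : Prop := filledCluster G x = Set.univ

/-- The filled forward cluster of `x` is blocked below by a decreasing function. -/
def IsBlockedBelow (G : Env) (x : ℤ × ℤ) : Prop :=
  ∃ W : ℤ → ℤ, Antitone W ∧ IsFLBF G W ∧ filledCluster G x = setGE W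

/-- The filled forward cluster of `x` is blocked above by a decreasing function. -/
def IsBlockedAbove (G : Env) (x : ℤ × ℤ) : Prop :=
  ∃ W : ℤ → ℤ, Antitone W ∧ IsFUBF G W ∧ filledCluster G x = setLE W

end DRE

/-!
The idea of the proof is as follows. From every site one can walk north-west (steps left and up) and
south-east (steps right and down). Two further almost sure properties of the environment carry everything else; the structure `Good` collects them.

* Every direction is available all along some arbitrarily high and some arbitrarily low translates of
  a given row segment (`ae_exists_translate_forall_mem`).
* Any two sites of one column have a common north-west descendant and a common south-east descendant
  (`ae_exists_reach_of_reach`). Indeed, let two walks prefer the vertical direction and look at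
  their positions on successive diagonals: until they meet their distance is a lazy symmetric random walk, so the
  probability of never meeting is a bounded harmonic function on `ℕ` that vanishes at `0`, and
  hence is zero (`law_neverMeet_eq_zero`).

Given the meeting property, whatever lies between two points of a cluster in a column is enclosed by
four monotone paths of the cluster, hence belongs to the filled cluster
(`Good.mem_filledCluster`). By the recurrence of open rows every cluster meets every column, and
boundedness does not depend on the column. Thus the filled cluster is everything when the cluster is unbounded in
both vertical directions. If it is bounded below only, its lower boundary `W` is finite in every
column by the recurrence of open rows, is decreasing because of the south-east paths, and blocks:
where `W` jumps, the cluster climbs along the jump (`Good.isFLBF_lower_boundary`). A half turn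
(`rot`) exchanges above and below.

It remains to see which case occurs. If the cluster of `x` is bounded below, then so is that of the
site above `x`. An event that is monotone under a translation is almost surely invariant, so it has
probability `0` or `1` (`law_eq_zero_or_one`). Both bounds cannot have probability `1`: the
cluster of the origin and that of a far higher site would be separated in a column, while they share
a site and therefore a site in this column (`not_law_lowerBdd_and_upperBdd`).
-/

namespace DRE

open ProbabilityTheory Set
open scoped symmDiff

/-! ### Independence and translation invariance -/

instance finite_dir : Finite Dir :=
  Finite.of_surjective ![Dir.left, Dir.right, Dir.up, Dir.down] fun e => by
    cases e
    exacts [⟨0, rfl⟩, ⟨1, rfl⟩, ⟨2, rfl⟩, ⟨3, rfl⟩]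

instance isProbabilityMeasure_law (μ : Measure (Set Dir)) [IsProbabilityMeasure μ] :
    IsProbabilityMeasure (law μ) := by
  unfold law; infer_instance

/-- The information carried by the local environments at the sites of `S`. -/
abbrev siteAlgebra (S : Set (ℤ × ℤ)) : MeasurableSpace Env :=
  ⨆ x ∈ S, MeasurableSpace.comap (fun G : Env => G x) inferInstance

lemma siteAlgebra_mono {S T : Set (ℤ × ℤ)} (h : S ⊆ T) : siteAlgebra S ≤ siteAlgebra T :=
  biSup_mono h

lemma siteAlgebra_le (S : Set (ℤ × ℤ)) : siteAlgebra S ≤ MeasurableSpace.pi :=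
  iSup₂_le fun x _ => (measurable_pi_apply x).comap_le

lemma measurableSet_siteAlgebra {S : Set (ℤ × ℤ)} {x : ℤ × ℤ} (hx : x ∈ S) (B : Set (Set Dir)) :
    MeasurableSet[siteAlgebra S] {G : Env | G x ∈ B} := by
  have h : MeasurableSpace.comap (fun G : Env => G x) inferInstance ≤ siteAlgebra S :=
    le_iSup₂_of_le x hx le_rfl
  exact h _ ⟨B, (Set.toFinite B).measurableSet, rfl⟩

lemma measurableSet_mem (x : ℤ × ℤ) (e : Dir) : MeasurableSet {G : Env | e ∈ G x} :=
  siteAlgebra_le _ _ (measurableSet_siteAlgebra (mem_univ x) {E | e ∈ E})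

lemma law_inter_of_disjoint (μ : Measure (Set Dir)) [IsProbabilityMeasure μ]
    {S T : Set (ℤ × ℤ)} (hST : Disjoint S T) {A B : Set Env}
    (hA : MeasurableSet[siteAlgebra S] A) (hB : MeasurableSet[siteAlgebra T] B) :
    law μ (A ∩ B) = law μ A * law μ B := by
  have h : iIndepFun (fun (x : ℤ × ℤ) (G : Env) => G x) (law μ) :=
    iIndepFun_infinitePi (P := fun _ : ℤ × ℤ => μ) (X := fun _ E => E) (fun _ => measurable_id)
  have h2 : Indep (siteAlgebra S) (siteAlgebra T) (law μ) :=
    indep_iSup_of_disjoint (fun x => (measurable_pi_apply x).comap_le) h.iIndep hST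
  exact (Indep_iff _ _ _).1 h2 A B hA hB

lemma law_site (μ : Measure (Set Dir)) [IsProbabilityMeasure μ] (x : ℤ × ℤ) (B : Set (Set Dir)) :
    law μ {G | G x ∈ B} = μ B := by
  have hB : MeasurableSet B := (Set.toFinite B).measurableSet
  have h := congrArg (fun ν : Measure (Set Dir) => ν B)
    (Measure.infinitePi_map_eval (fun _ : ℤ × ℤ => μ) x)
  rwa [Measure.map_apply (by fun_prop) hB] at h

/-- The environment seen from `v`. -/
def shift (v : ℤ × ℤ) (G : Env) : Env := fun y => G (y + v)

lemma measurable_shift (v : ℤ × ℤ) : Measurable (shift v) :=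
  measurable_pi_lambda _ fun y => measurable_pi_apply (y + v)

lemma measurePreserving_shift (μ : Measure (Set Dir)) [IsProbabilityMeasure μ] (v : ℤ × ℤ) :
    MeasurePreserving (shift v) (law μ) (law μ) := by
  refine ⟨measurable_shift v, Measure.eq_infinitePi _ fun s t ht => ?_⟩
  rw [Measure.map_apply (measurable_shift v)
    (.pi s.countable_toSet fun i _ => ht i)]
  have : shift v ⁻¹' (Set.pi (s : Set (ℤ × ℤ)) t) =
      Set.pi ((s.map (Equiv.addRight v).toEmbedding : Finset (ℤ × ℤ)) : Set (ℤ × ℤ))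
        (fun y => t (y - v)) := by
    ext G
    simp only [shift, Set.mem_pi, mem_preimage, Finset.coe_map, mem_image, Finset.mem_coe]
    constructor
    · rintro h _ ⟨y, hy, rfl⟩
      simpa using h y hy
    · intro h y hy
      simpa using h (y + v) ⟨y, hy, rfl⟩
  rw [this, law, Measure.infinitePi_pi _ (fun i _ => ht _), Finset.prod_map]
  simp

lemma shift_zero (G : Env) : shift 0 G = G := by
  funext y; simp [shift]

lemma shift_shift (v w : ℤ × ℤ) (G : Env) : shift v (shift w G) = shift (v + w) G := by
  funext y; simp [shift, add_assoc]

/-! ### A zero-one law for events monotone under a translation -/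

lemma measurableSet_siteAlgebra_of_cylinder (s : Finset (ℤ × ℤ))
    (B : Set ((i : s) → Set Dir)) : MeasurableSet[siteAlgebra s] (cylinder s B) := by
  classical
  have : cylinder s B = ⋃ f ∈ B, ⋂ i : s, {G : Env | G i ∈ ({f i} : Set (Set Dir))} := by
    ext G
    simp only [mem_cylinder, mem_iUnion, mem_iInter, mem_ofPred_eq, mem_singleton_iff, exists_prop]
    constructor
    · intro h; exact ⟨_, h, fun i => rfl⟩
    · rintro ⟨f, hf, h⟩
      convert hf using 1
      funext i; exact h i
  rw [this]
  refine MeasurableSet.biUnion (Set.toFinite B).countable fun f _ => ?_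
  exact MeasurableSet.iInter fun i => measurableSet_siteAlgebra i.2 _

lemma shift_preimage_siteAlgebra {S : Set (ℤ × ℤ)} {A : Set Env} (v : ℤ × ℤ)
    (hA : MeasurableSet[siteAlgebra S] A) :
    MeasurableSet[siteAlgebra ((· + v) '' S)] (shift v ⁻¹' A) := by
  have : Measurable[siteAlgebra ((· + v) '' S), siteAlgebra S] (shift v) := by
    refine measurable_iff_comap_le.2 ?_
    simp only [siteAlgebra, MeasurableSpace.comap_iSup, MeasurableSpace.comap_comp]
    refine iSup₂_le fun x hx => ?_
    exact le_iSup₂_of_le (x + v) ⟨x, hx, rfl⟩ le_rfl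
  exact this hA

/-- A finite set of sites can be translated off itself along `v`. -/
lemma exists_disjoint_translate (s : Finset (ℤ × ℤ)) {v : ℤ × ℤ} (hv : v ≠ 0) :
    ∃ n : ℕ, Disjoint (s : Set (ℤ × ℤ)) ((· + n • v) '' s) := by
  classical
  have hinj : Function.Injective (fun n : ℕ => n • v) := by
    intro m n h
    have h1 : (m : ℤ) * v.1 = n * v.1 := by simpa using congrArg Prod.fst h
    have h2 : (m : ℤ) * v.2 = n * v.2 := by simpa using congrArg Prod.snd h
    by_contra hmn
    have hmn' : (m : ℤ) ≠ n := by exact_mod_cast hmn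
    exact hv (Prod.ext ((mul_eq_mul_left_iff.1 (by linarith : ((m : ℤ) - n) * v.1 =
      (m - n) * 0)).resolve_right (sub_ne_zero.2 hmn')) ((mul_eq_mul_left_iff.1 (by linarith :
      ((m : ℤ) - n) * v.2 = (m - n) * 0)).resolve_right (sub_ne_zero.2 hmn')))
  let D : Finset (ℤ × ℤ) := (s ×ˢ s).image fun p => p.1 - p.2
  obtain ⟨n, hn⟩ : ∃ n : ℕ, n • v ∉ D := by
    by_contra! h
    exact (Set.infinite_range_of_injective hinj)
      (D.finite_toSet.subset (by rintro _ ⟨n, rfl⟩; exact h n))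
  refine ⟨n, Set.disjoint_left.2 ?_⟩
  rintro x hx ⟨y, hy, rfl⟩
  exact hn (Finset.mem_image.2 ⟨(y + n • v, y), Finset.mem_product.2 ⟨hx, hy⟩, by simp⟩)

/-- Zero-one law for events that are almost surely monotone under a translation. Such an event is
almost surely invariant, while a cylinder event approximating it is independent of its translate by
a large multiple of `v`. -/
theorem law_eq_zero_or_one (μ : Measure (Set Dir)) [IsProbabilityMeasure μ] {v : ℤ × ℤ}
    (hv : v ≠ 0) {A : Set Env} (hA : MeasurableSet A)
    (hsub : ∀ᵐ G ∂law μ, G ∈ A → shift v G ∈ A) : law μ A = 0 ∨ law μ A = 1 := by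
  set P := law μ
  have hpres : ∀ n : ℕ, MeasurePreserving (shift (n • v)) P P := fun n =>
    measurePreserving_shift μ _
  have hsubn : ∀ n : ℕ, ∀ᵐ G ∂P, G ∈ A → shift (n • v) G ∈ A := by
    intro n
    induction n with
    | zero => exact Filter.Eventually.of_forall fun G hG => by simpa [shift_zero] using hG
    | succ n ih =>
      filter_upwards [ih, (hpres n).quasiMeasurePreserving.ae hsub] with G h1 h2 hG
      have h := h2 (h1 hG)
      rwa [shift_shift, ← succ_nsmul'] at h
  have hclose : ∀ ε : ℝ, 0 < ε → |P.real A - P.real A * P.real A| ≤ 4 * ε := by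
    intro ε hε
    obtain ⟨C, hC, hCA⟩ := exists_measure_symmDiff_lt_of_generateFrom_isSetRing (μ := P)
      (C := measurableCylinders fun _ : ℤ × ℤ => Set Dir) isSetRing_measurableCylinders
      ⟨{univ}, by simp, singleton_subset_iff.2 (univ_mem_measurableCylinders _), by simp⟩
      generateFrom_measurableCylinders.symm hA (ε := ENNReal.ofReal ε) (by simpa using hε)
    obtain ⟨s, B, -, rfl⟩ := (mem_measurableCylinders C).1 hC
    set C : Set Env := cylinder (α := fun _ : ℤ × ℤ => Set Dir) s B
    have hCs : MeasurableSet[siteAlgebra s] C := measurableSet_siteAlgebra_of_cylinder s B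
    have hCm : MeasurableSet C := siteAlgebra_le _ _ hCs
    -- `C` and its translate depend on disjoint sets of sites, and both are close to `A`
    obtain ⟨n, hn⟩ := exists_disjoint_translate s hv
    have hind : P (C ∩ shift (n • v) ⁻¹' C) = P C * P C := by
      rw [law_inter_of_disjoint μ hn hCs (shift_preimage_siteAlgebra _ hCs),
        (hpres n).measure_preimage hCm.nullMeasurableSet]
    have hindr : P.real (C ∩ shift (n • v) ⁻¹' C) = P.real C * P.real C := by
      rw [Measure.real, hind, ENNReal.toReal_mul, Measure.real]
    have hd : P.real (C ∆ A) ≤ ε :=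
      ENNReal.toReal_le_of_le_ofReal hε.le hCA.le
    have hd' : P.real (shift (n • v) ⁻¹' (C ∆ A)) ≤ ε := by
      rw [Measure.real, (hpres n).measure_preimage (hCm.symmDiff hA).nullMeasurableSet]
      exact hd
    have h1 : |P.real C - P.real A| ≤ ε :=
      (abs_measureReal_sub_le_measureReal_symmDiff hCm.nullMeasurableSet hA.nullMeasurableSet).trans hd
    have h2 : |P.real (C ∩ shift (n • v) ⁻¹' C) - P.real A| ≤ 2 * ε := by
      have hsd : ∀ᵐ G ∂P, G ∈ (C ∩ shift (n • v) ⁻¹' C) ∆ A →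
          G ∈ (C ∆ A) ∪ shift (n • v) ⁻¹' (C ∆ A) := by
        filter_upwards [hsubn n] with G hG hGC
        simp only [Set.mem_symmDiff, mem_inter_iff, mem_preimage, mem_union] at hGC ⊢
        tauto
      refine (abs_measureReal_sub_le_measureReal_symmDiff
        (hCm.inter (measurable_shift _ hCm)).nullMeasurableSet hA.nullMeasurableSet).trans ?_
      refine (ENNReal.toReal_mono (measure_ne_top _ _) (measure_mono_ae hsd)).trans
        ((measureReal_union_le _ _).trans ?_)
      linarith
    have hC1 : P.real C ≤ 1 := measureReal_le_one
    have hC0 : 0 ≤ P.real C := measureReal_nonneg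
    have hA1 : P.real A ≤ 1 := measureReal_le_one
    have hA0 : 0 ≤ P.real A := measureReal_nonneg
    rw [hindr] at h2
    rw [abs_le] at h1 h2 ⊢
    constructor <;> nlinarith
  have h0 : P.real A - P.real A * P.real A = 0 := by
    by_contra hne
    have hpos := abs_pos.2 hne
    have := hclose _ (show 0 < |P.real A - P.real A * P.real A| / 8 by positivity)
    linarith
  have : P.real A * (1 - P.real A) = 0 := by linarith
  rcases mul_eq_zero.1 this with h | h
  · left; simpa [Measure.real, ENNReal.toReal_eq_zero_iff] using h
  · right
    have h' : P.real A = 1 := by linarith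
    rw [← ENNReal.toReal_eq_one_iff]; exact h'

/-! ### Recurrence of available directions -/

lemma meets_singleton (e : Dir) : meets {e} = {E | e ∈ E} := by
  ext E; simp [meets]

/-- Some translate of a finite set of sites along `v` allows the direction `e` throughout: this
event is monotone under the translation, and it has positive probability. -/
theorem ae_exists_translate_forall_mem (μ : Measure (Set Dir)) [IsProbabilityMeasure μ] {e : Dir}
    (he : 0 < μ (meets {e})) {v : ℤ × ℤ} (hv : v ≠ 0) (F : Finset (ℤ × ℤ)) :
    ∀ᵐ G ∂law μ, ∃ n : ℕ, ∀ x ∈ F, e ∈ G (x + n • v) := by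
  set A : Set Env := {G | ∃ n : ℕ, ∀ x ∈ F, e ∈ G (x + n • v)}
  have hA : MeasurableSet A := by
    have : A = ⋃ n : ℕ, ⋂ x ∈ F, {G : Env | e ∈ G (x + n • v)} := by
      ext G; simp [A]
    rw [this]
    exact MeasurableSet.iUnion fun n => Finset.measurableSet_biInter _ fun x _ =>
      measurableSet_mem _ e
  have hsub : A ⊆ shift (-v) ⁻¹' A := by
    rintro G ⟨n, hn⟩
    refine ⟨n + 1, fun x hx => ?_⟩
    have : x + (n + 1) • v + -v = x + n • v := by rw [add_smul, one_smul]; abel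
    rw [shift, this]
    exact hn x hx
  have hpos : law μ A ≠ 0 := by
    have hle : Set.pi (F : Set (ℤ × ℤ)) (fun _ => {E : Set Dir | e ∈ E}) ⊆ A := by
      intro G hG
      exact ⟨0, fun x hx => by simpa using hG x hx⟩
    have hpi : law μ (Set.pi (F : Set (ℤ × ℤ)) (fun _ => {E : Set Dir | e ∈ E})) ≠ 0 := by
      rw [law, Measure.infinitePi_pi _ (fun _ _ => (Set.toFinite _).measurableSet)]
      rw [Finset.prod_const]
      rw [meets_singleton] at he
      exact pow_ne_zero _ he.ne'
    intro h0
    exact hpi (measure_mono_null hle h0)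
  have h1 : law μ A = 1 := (law_eq_zero_or_one μ (neg_ne_zero.2 hv) hA
    (Filter.Eventually.of_forall hsub)).resolve_left hpos
  exact (prob_compl_eq_zero_iff hA).2 h1

/-! ### Coalescence of walks -/

open Classical in
/-- One step of the walk which follows `e` where `e` is available, and `f` elsewhere. -/
noncomputable def walk (e f : Dir) (G : Env) (x : ℤ × ℤ) : ℤ × ℤ :=
  if e ∈ G x then x + e.vec else x + f.vec

/-- The walks from `x` and from `y`, run simultaneously, never meet. -/
def NeverMeet (e f : Dir) (x y : ℤ × ℤ) : Set Env :=
  {G | ∀ j, (walk e f G)^[j] x ≠ (walk e f G)^[j] y}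

section Coalescence

-- `ℓ` is the level of a site: every step of the walk raises it by one
variable {e f : Dir} {ℓ : ℤ × ℤ →+ ℤ}

lemma walk_of_mem {G : Env} {x : ℤ × ℤ} (h : e ∈ G x) : walk e f G x = x + e.vec := if_pos h

lemma walk_of_notMem {G : Env} {x : ℤ × ℤ} (h : e ∉ G x) : walk e f G x = x + f.vec := if_neg h

lemma walk_shift (v : ℤ × ℤ) (G : Env) (x : ℤ × ℤ) :
    walk e f (shift v G) x + v = walk e f G (x + v) := by
  unfold walk shift
  split_ifs <;> abel

lemma iterate_walk_shift (v : ℤ × ℤ) (G : Env) (j : ℕ) (x : ℤ × ℤ) :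
    (walk e f (shift v G))^[j] x + v = (walk e f G)^[j] (x + v) := by
  induction j generalizing x with
  | zero => rfl
  | succ j ih => rw [Function.iterate_succ_apply, Function.iterate_succ_apply, ih, walk_shift]

/-- The walk from `x` only sees the environment on the level of `x` and above. -/
lemma measurableSet_iterate_walk (he : ℓ e.vec = 1) (hf : ℓ f.vec = 1) (j : ℕ) (x w : ℤ × ℤ) :
    MeasurableSet[siteAlgebra {z | ℓ x ≤ ℓ z}] {G | (walk e f G)^[j] x = w} := by
  induction j generalizing x with
  | zero => simp only [Function.iterate_zero, id_eq]; exact MeasurableSet.const _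
  | succ j ih =>
    have hA : MeasurableSet[siteAlgebra {z | ℓ x ≤ ℓ z}] {G : Env | e ∈ G x} :=
      measurableSet_siteAlgebra (x := x) (le_refl (ℓ x)) {E | e ∈ E}
    have hle : ∀ g : Dir, ℓ g.vec = 1 → siteAlgebra {z | ℓ (x + g.vec) ≤ ℓ z} ≤
        siteAlgebra {z | ℓ x ≤ ℓ z} := by
      intro g hg
      refine siteAlgebra_mono fun z hz => ?_
      simp only [mem_ofPred_eq, map_add, hg] at hz ⊢
      omega
    have : {G | (walk e f G)^[j + 1] x = w} =
        {G : Env | e ∈ G x} ∩ {G | (walk e f G)^[j] (x + e.vec) = w} ∪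
        {G : Env | e ∈ G x}ᶜ ∩ {G | (walk e f G)^[j] (x + f.vec) = w} := by
      ext G
      by_cases h : e ∈ G x <;> simp [h, walk]
    rw [this]
    exact (hA.inter (hle e he _ (ih _))).union (hA.compl.inter (hle f hf _ (ih _)))

lemma measurableSet_neverMeet (he : ℓ e.vec = 1) (hf : ℓ f.vec = 1) {x y : ℤ × ℤ}
    (hxy : ℓ x = ℓ y) : MeasurableSet[siteAlgebra {z | ℓ x ≤ ℓ z}] (NeverMeet e f x y) := by
  have : NeverMeet e f x y = (⋃ (j : ℕ) (w : ℤ × ℤ),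
      {G | (walk e f G)^[j] x = w} ∩ {G | (walk e f G)^[j] y = w})ᶜ := by
    ext G
    simp only [NeverMeet, mem_ofPred_eq, mem_compl_iff, mem_iUnion, mem_inter_iff, not_exists]
    exact ⟨fun h j w h1 => h j (h1.1.trans h1.2.symm), fun h j h1 => h j _ ⟨h1, rfl⟩⟩
  rw [this]
  refine MeasurableSet.compl (MeasurableSet.iUnion fun j => MeasurableSet.iUnion fun w => ?_)
  refine (measurableSet_iterate_walk he hf j x w).inter ?_
  rw [hxy]
  exact measurableSet_iterate_walk he hf j y w

lemma law_neverMeet_add (μ : Measure (Set Dir)) [IsProbabilityMeasure μ] (he : ℓ e.vec = 1)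
    (hf : ℓ f.vec = 1) (x : ℤ × ℤ) {z : ℤ × ℤ} (hz : ℓ z = 0) :
    law μ (NeverMeet e f x (x + z)) = law μ (NeverMeet e f 0 z) := by
  have : NeverMeet e f x (x + z) = shift x ⁻¹' NeverMeet e f 0 z := by
    ext G
    have h : ∀ j y, (walk e f (shift x G))^[j] y = (walk e f G)^[j] (y + x) - x := fun j y => by
      rw [← iterate_walk_shift, add_sub_cancel_right]
    simp [NeverMeet, h, add_comm z x]
  rw [this, (measurePreserving_shift μ x).measure_preimage]
  exact (siteAlgebra_le _ _ (measurableSet_neverMeet he hf (by simp [hz]))).nullMeasurableSet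

/-- The local environments at two sites of a level are independent of each other and of all that
happens to walks above this level. -/
lemma law_inter_neverMeet (μ : Measure (Set Dir)) [IsProbabilityMeasure μ] (he : ℓ e.vec = 1)
    (hf : ℓ f.vec = 1) {x y x' y' : ℤ × ℤ} (hne : x ≠ y) (hxy : ℓ x = ℓ y) (hx : ℓ x' = ℓ x + 1)
    (hy : ℓ y' = ℓ x + 1) (B₁ B₂ : Set (Set Dir)) :
    (law μ).real ({G | G x ∈ B₁} ∩ {G | G y ∈ B₂} ∩ NeverMeet e f x' y') =
      μ.real B₁ * μ.real B₂ * (law μ).real (NeverMeet e f x' y') := by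
  have h1 : MeasurableSet[siteAlgebra {x}] {G : Env | G x ∈ B₁} :=
    measurableSet_siteAlgebra (mem_singleton _) _
  have h2 : MeasurableSet[siteAlgebra {y}] {G : Env | G y ∈ B₂} :=
    measurableSet_siteAlgebra (mem_singleton _) _
  have h12 : MeasurableSet[siteAlgebra {x, y}] ({G : Env | G x ∈ B₁} ∩ {G | G y ∈ B₂}) :=
    (measurableSet_siteAlgebra (by simp) _).inter (measurableSet_siteAlgebra (by simp) _)
  have hd : Disjoint ({x, y} : Set (ℤ × ℤ)) {z | ℓ x' ≤ ℓ z} := by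
    refine Set.disjoint_left.2 ?_
    rintro z (rfl | rfl) hz
    · simp only [mem_ofPred_eq] at hz; omega
    · simp only [mem_ofPred_eq] at hz; omega
  have h3 := law_inter_of_disjoint μ hd h12 (measurableSet_neverMeet he hf (hx.trans hy.symm))
  rw [law_inter_of_disjoint μ (by simpa using hne) h1 h2, law_site, law_site] at h3
  simp only [Measure.real, h3, ENNReal.toReal_mul]

/-- A bounded nonnegative sequence that starts at zero and is subharmonic vanishes. -/
lemma eq_zero_of_subharmonic {H : ℕ → ℝ} (h0 : H 0 = 0) (hnn : ∀ k, 0 ≤ H k) (hb : ∀ k, H k ≤ 1)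
    (hsub : ∀ k, 2 * H (k + 1) ≤ H k + H (k + 2)) (k : ℕ) : H k = 0 := by
  -- the increments are nondecreasing, so a positive value would force linear growth
  have hinc : ∀ m n : ℕ, H (m + 1) - H m ≤ H (m + n + 1) - H (m + n) := by
    intro m n
    induction n with
    | zero => simp
    | succ n ih => have := hsub (m + n); rw [← add_assoc m n 1]; linarith
  have hlin : ∀ m n : ℕ, H m + n * (H (m + 1) - H m) ≤ H (m + n) := by
    intro m n
    induction n with
    | zero => simp
    | succ n ih => have := hinc m n; push_cast; rw [← add_assoc m n 1]; linarith
  have hstep : ∀ m, H (m + 1) - H m ≤ 0 := by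
    intro m
    by_contra! hpos
    obtain ⟨n, hn⟩ := exists_nat_gt (1 / (H (m + 1) - H m))
    rw [div_lt_iff₀ hpos] at hn
    linarith [hlin m n, hb (m + n), hnn m]
  induction k with
  | zero => exact h0
  | succ k ih => linarith [hstep k, hnn (k + 1)]

/-- Two walks on a common level meet: their distance is a lazy symmetric walk, so the probability
of never meeting is a bounded harmonic function of the initial distance, vanishing at zero. -/
theorem law_neverMeet_eq_zero (μ : Measure (Set Dir)) [IsProbabilityMeasure μ] (he : ℓ e.vec = 1)
    (hf : ℓ f.vec = 1) (hef : e ≠ f) (h0 : μ.real {E | e ∈ E} ≠ 0) (h1 : μ.real {E | e ∈ E} ≠ 1)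
    (x : ℤ × ℤ) (k : ℕ) : law μ (NeverMeet e f x (x + k • (e.vec - f.vec))) = 0 := by
  set p := μ.real {E | e ∈ E}
  set δ := e.vec - f.vec
  have hp0 : 0 < p := lt_of_le_of_ne measureReal_nonneg (Ne.symm h0)
  have hp1 : p < 1 := lt_of_le_of_ne measureReal_le_one h1
  have hq : μ.real {E | e ∈ E}ᶜ = 1 - p := by
    rw [measureReal_compl (Set.toFinite _).measurableSet]; simp [p]
  have hδ : ℓ δ = 0 := by simp [δ, he, hf]
  have hδk : ∀ k : ℕ, ℓ (k • δ) = 0 := fun k => by rw [map_nsmul, hδ, smul_zero]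
  have hδ0 : δ ≠ 0 := by
    revert hef; cases e <;> cases f <;> simp [δ, Dir.vec]
  have hkδ : ∀ k : ℕ, (k + 1) • δ ≠ 0 := by
    intro k h
    rcases smul_eq_zero.1 h with h | h
    · omega
    · exact hδ0 h
  set H : ℕ → ℝ := fun k => (law μ).real (NeverMeet e f 0 (k • δ))
  have hH : ∀ (k : ℕ) (u w : ℤ × ℤ), w = u + k • δ → (law μ).real (NeverMeet e f u w) = H k := by
    rintro k u w rfl
    simp only [H, Measure.real, law_neverMeet_add μ he hf u (hδk k)]
  have hsub : ∀ k, 2 * H (k + 1) ≤ H k + H (k + 2) := by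
    intro k
    set y : ℤ × ℤ := (k + 1) • δ
    have hne : (0 : ℤ × ℤ) ≠ y := (hkδ k).symm
    have hy : ℓ y = 0 := hδk _
    set I : Set (Set Dir) := {E | e ∈ E}
    -- the four joint outcomes of the first steps; the two mixed ones change the distance
    have hcover : NeverMeet e f 0 y ⊆
        (({G | G 0 ∈ I} ∩ {G | G y ∈ I} ∩ NeverMeet e f (0 + e.vec) (y + e.vec)) ∪
          ({G | G 0 ∈ I} ∩ {G | G y ∈ Iᶜ} ∩ NeverMeet e f (0 + e.vec) (y + f.vec))) ∪
        (({G | G 0 ∈ Iᶜ} ∩ {G | G y ∈ I} ∩ NeverMeet e f (0 + f.vec) (y + e.vec)) ∪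
          ({G | G 0 ∈ Iᶜ} ∩ {G | G y ∈ Iᶜ} ∩ NeverMeet e f (0 + f.vec) (y + f.vec))) := by
      intro G hG
      have hG' : G ∈ NeverMeet e f (walk e f G 0) (walk e f G y) := fun j => hG (j + 1)
      by_cases ha : e ∈ G 0 <;> by_cases hb : e ∈ G y
      · rw [walk_of_mem ha, walk_of_mem hb] at hG'
        exact Or.inl (Or.inl ⟨⟨ha, hb⟩, hG'⟩)
      · rw [walk_of_mem ha, walk_of_notMem hb] at hG'
        exact Or.inl (Or.inr ⟨⟨ha, hb⟩, hG'⟩)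
      · rw [walk_of_notMem ha, walk_of_mem hb] at hG'
        exact Or.inr (Or.inl ⟨⟨ha, hb⟩, hG'⟩)
      · rw [walk_of_notMem ha, walk_of_notMem hb] at hG'
        exact Or.inr (Or.inr ⟨⟨ha, hb⟩, hG'⟩)
    have hle := (measureReal_mono (μ := law μ) hcover).trans ((measureReal_union_le _ _).trans
      (add_le_add (measureReal_union_le _ _) (measureReal_union_le _ _)))
    have hl : ∀ g : Dir, ℓ g.vec = 1 → ∀ z, ℓ z = 0 → ℓ (z + g.vec) = ℓ (0 : ℤ × ℤ) + 1 := by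
      intro g hg z hz; simp [hg, hz]
    have h00 : ℓ (0 : ℤ × ℤ) = 0 := map_zero ℓ
    have h0y : ℓ (0 : ℤ × ℤ) = ℓ y := h00.trans hy.symm
    rw [law_inter_neverMeet μ he hf hne h0y (hl e he _ h00) (hl e he _ hy),
      law_inter_neverMeet μ he hf hne h0y (hl e he _ h00) (hl f hf _ hy),
      law_inter_neverMeet μ he hf hne h0y (hl f hf _ h00) (hl e he _ hy),
      law_inter_neverMeet μ he hf hne h0y (hl f hf _ h00) (hl f hf _ hy),
      hH (k + 1) 0 y (by simp [y]), hH (k + 1) _ _ (by simp only [y]; abel),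
      hH k _ _ (by simp only [y, δ, add_smul, one_smul]; abel),
      hH (k + 2) _ _ (by simp only [y, δ, add_smul, one_smul, two_smul]; abel),
      hH (k + 1) _ _ (by simp only [y]; abel), hq] at hle
    have hpq : 0 < p * (1 - p) := mul_pos hp0 (by linarith)
    refine le_of_mul_le_mul_left ?_ hpq
    change H (k + 1) ≤ p * p * H (k + 1) + p * (1 - p) * H k +
      ((1 - p) * p * H (k + 2) + (1 - p) * (1 - p) * H (k + 1)) at hle
    linarith
  have hz : H 0 = 0 := by
    have : NeverMeet e f 0 ((0 : ℕ) • δ) = ∅ := by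
      ext G; simp [NeverMeet]
    simp only [H, this, measureReal_empty]
  have := eq_zero_of_subharmonic hz (fun _ => measureReal_nonneg) (fun _ => measureReal_le_one)
    hsub k
  rw [law_neverMeet_add μ he hf x (hδk k)]
  exact (measureReal_eq_zero_iff).1 this

end Coalescence

/-! ### Monotone paths and good environments -/

/-- One directed edge of `G` in one of the directions `e`, `f`. -/
def StepIn (G : Env) (e f : Dir) (x y : ℤ × ℤ) : Prop :=
  (e ∈ G x ∧ y = x + e.vec) ∨ (f ∈ G x ∧ y = x + f.vec)

/-- `y` is reached from `x` by an open path that uses only the directions `e` and `f`. -/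
def Reach (G : Env) (e f : Dir) : ℤ × ℤ → ℤ × ℤ → Prop := Relation.ReflTransGen (StepIn G e f)

lemma Reach.connected {G : Env} {e f : Dir} {x y : ℤ × ℤ} (h : Reach G e f x y) :
    Connected G x y :=
  Relation.ReflTransGen.mono (fun _ _ hs => hs.elim (fun h => ⟨e, h.1, h.2⟩)
    (fun h => ⟨f, h.1, h.2⟩)) _ _ h

/-- The properties of the environment, almost surely valid, on which the description of the
clusters rests. -/
structure Good (G : Env) : Prop where
  nw : ∀ x, Dir.up ∈ G x ∨ Dir.left ∈ G x
  se : ∀ x, Dir.down ∈ G x ∨ Dir.right ∈ G x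
  row_above : ∀ (e : Dir) (a a' N : ℤ), ∃ b, N ≤ b ∧ ∀ c, a ≤ c → c ≤ a' → e ∈ G (c, b)
  row_below : ∀ (e : Dir) (a a' N : ℤ), ∃ b, b ≤ N ∧ ∀ c, a ≤ c → c ≤ a' → e ∈ G (c, b)
  nw_meet : ∀ a b b' : ℤ, ∃ m, Reach G .up .left (a, b) m ∧ Reach G .up .left (a, b') m
  se_meet : ∀ a b b' : ℤ, ∃ m, Reach G .down .right (a, b) m ∧ Reach G .down .right (a, b') m

/-! ### The half turn -/

/-- The opposite direction. -/
def Dir.neg : Dir → Dir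
  | .left => .right
  | .right => .left
  | .up => .down
  | .down => .up

lemma Dir.neg_neg (e : Dir) : e.neg.neg = e := by cases e <;> rfl

lemma Dir.vec_neg (e : Dir) : e.neg.vec = -e.vec := by cases e <;> rfl

/-- The environment rotated by a half turn about the origin. This rotation exchanges above and
below while it preserves decreasing functions. -/
def rot (G : Env) : Env := fun x => {e | e.neg ∈ G (-x)}

lemma mem_rot {G : Env} {x : ℤ × ℤ} {e : Dir} : e ∈ rot G x ↔ e.neg ∈ G (-x) := Iff.rfl

lemma rot_rot (G : Env) : rot (rot G) = G := by
  funext x; ext e; simp [mem_rot, Dir.neg_neg]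

lemma connected_rot_neg {G : Env} {x y : ℤ × ℤ} (h : Connected G x y) :
    Connected (rot G) (-x) (-y) := by
  refine Relation.ReflTransGen.lift (fun z => -z) ?_ _ _ h
  rintro u w ⟨e, he, rfl⟩
  exact ⟨e.neg, by simpa [mem_rot, Dir.neg_neg] using he, by rw [Dir.vec_neg]; exact neg_add _ _⟩

lemma connected_rot {G : Env} {x y : ℤ × ℤ} : Connected (rot G) x y ↔ Connected G (-x) (-y) := by
  constructor
  · intro h; simpa [rot_rot] using connected_rot_neg h
  · intro h; simpa using connected_rot_neg h

lemma reach_rot_neg {G : Env} {e f : Dir} {x y : ℤ × ℤ} (h : Reach G e f x y) :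
    Reach (rot G) e.neg f.neg (-x) (-y) := by
  refine Relation.ReflTransGen.lift (fun z => -z) ?_ _ _ h
  rintro u w (⟨he, rfl⟩ | ⟨hf, rfl⟩)
  · exact Or.inl ⟨by simpa [mem_rot, Dir.neg_neg] using he, by rw [Dir.vec_neg]; exact neg_add _ _⟩
  · exact Or.inr ⟨by simpa [mem_rot, Dir.neg_neg] using hf, by rw [Dir.vec_neg]; exact neg_add _ _⟩

protected lemma Good.rot {G : Env} (hG : Good G) : Good (rot G) where
  nw x := hG.se (-x)
  se x := hG.nw (-x)
  row_above e a a' N := by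
    obtain ⟨b, hb, h⟩ := hG.row_below e.neg (-a') (-a) (-N)
    exact ⟨-b, by omega, fun c h1 h2 => by simpa [mem_rot] using h (-c) (by omega) (by omega)⟩
  row_below e a a' N := by
    obtain ⟨b, hb, h⟩ := hG.row_above e.neg (-a') (-a) (-N)
    exact ⟨-b, by omega, fun c h1 h2 => by simpa [mem_rot] using h (-c) (by omega) (by omega)⟩
  nw_meet a b b' := by
    obtain ⟨m, h1, h2⟩ := hG.se_meet (-a) (-b) (-b')
    exact ⟨-m, by simpa [Dir.neg] using reach_rot_neg h1, by simpa [Dir.neg] using reach_rot_neg h2⟩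
  se_meet a b b' := by
    obtain ⟨m, h1, h2⟩ := hG.nw_meet (-a) (-b) (-b')
    exact ⟨-m, by simpa [Dir.neg] using reach_rot_neg h1, by simpa [Dir.neg] using reach_rot_neg h2⟩

/-! ### Sites enclosed by monotone paths -/

section NorthWest

variable {G : Env}

lemma Reach.nw_le {x y : ℤ × ℤ} (h : Reach G .up .left x y) : y.1 ≤ x.1 ∧ x.2 ≤ y.2 := by
  induction h with
  | refl => exact ⟨le_rfl, le_rfl⟩
  | tail _ hs ih =>
    rcases hs with ⟨-, rfl⟩ | ⟨-, rfl⟩ <;> simp [Dir.vec] <;> omega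

/-- A north-west path that starts in column `c`, not above height `d`, either visits `(c, d)`, or
ends in the column below `d`, or leaves the column below `d`. -/
lemma Reach.nw_visits_or {p m : ℤ × ℤ} {c d : ℤ} (h : Reach G .up .left p m) (hc : p.1 = c)
    (hd : p.2 ≤ d) : Reach G .up .left p (c, d) ∨ (m.1 = c ∧ m.2 < d) ∨
      ∃ e < d, Reach G .up .left p (c - 1, e) ∧ Reach G .up .left (c - 1, e) m := by
  induction h using Relation.ReflTransGen.head_induction_on with
  | refl =>
    rcases hd.eq_or_lt with hd | hd
    · left; rw [← hc, ← hd]; exact .refl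
    · exact Or.inr (Or.inl ⟨hc, hd⟩)
  | @head p q hs hq ih =>
    rcases hd.eq_or_lt with hd | hd
    · left; rw [← hc, ← hd]; exact .refl
    rcases id hs with ⟨-, rfl⟩ | ⟨-, rfl⟩
    · rcases ih (by simpa [Dir.vec] using hc) (by simp [Dir.vec]; omega) with h | h | ⟨e, he, h1, h2⟩
      · exact Or.inl (h.head hs)
      · exact Or.inr (Or.inl h)
      · exact Or.inr (Or.inr ⟨e, he, h1.head hs, h2⟩)
    · have hp : p + Dir.left.vec = (c - 1, p.2) := by
        ext <;> simp [Dir.vec, ← hc]; rfl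
      rw [hp] at hs hq
      exact Or.inr (Or.inr ⟨p.2, hd, .single hs, hq⟩)

lemma Reach.nw_exists_left {p m : ℤ × ℤ} {c : ℤ} (h : Reach G .up .left p m) (hc : p.1 = c)
    (hm : m.1 < c) : ∃ e, p.2 ≤ e ∧ Reach G .up .left p (c - 1, e) ∧
      Reach G .up .left (c - 1, e) m := by
  induction h using Relation.ReflTransGen.head_induction_on with
  | refl => omega
  | @head p q hs hq ih =>
    rcases id hs with ⟨-, rfl⟩ | ⟨-, rfl⟩
    · obtain ⟨e, he, h1, h2⟩ := ih (by simpa [Dir.vec] using hc)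
      refine ⟨e, ?_, h1.head hs, h2⟩
      simp [Dir.vec] at he; omega
    · have hp : p + Dir.left.vec = (c - 1, p.2) := by
        ext <;> simp [Dir.vec, ← hc]; rfl
      rw [hp] at hs hq
      exact ⟨p.2, le_rfl, .single hs, hq⟩

lemma Reach.nw_exists_right {p q : ℤ × ℤ} {c : ℤ} (h : Reach G .up .left p q) (hc : q.1 = c)
    (hp : c < p.1) : ∃ e, e ≤ q.2 ∧ Reach G .up .left p (c + 1, e) ∧
      Reach G .up .left (c + 1, e) (c, e) ∧ Reach G .up .left (c, e) q := by
  induction h with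
  | refl => omega
  | @tail u w hu hs ih =>
    rcases id hs with ⟨-, rfl⟩ | ⟨-, rfl⟩
    · obtain ⟨e, he, h1, h2, h3⟩ := ih (by simpa [Dir.vec] using hc)
      exact ⟨e, by simp [Dir.vec]; omega, h1, h2, h3.tail hs⟩
    · have hu' : u = (c + 1, u.2) := by
        ext
        · simp [Dir.vec] at hc; simp; omega
        · rfl
      have hw : u + Dir.left.vec = (c, u.2) := by
        ext
        · exact hc
        · simp [Dir.vec]
      rw [hw] at hs ⊢
      refine ⟨u.2, le_rfl, ?_, ?_, .refl⟩
      · rwa [← hu']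
      · rw [← hu']; exact .single hs

/-- The sites north-west of column `a` between a north-west path from `(a, l)` to `m` and a
north-west path from `(a, h)` to `m`. -/
def Pocket (G : Env) (a l h : ℤ) (m z : ℤ × ℤ) : Prop :=
  z.1 ≤ a ∧
  (∃ d, z.2 < d ∧ Reach G .up .left (a, h) (z.1, d) ∧ Reach G .up .left (z.1, d) m) ∧
  (∃ d, d < z.2 ∧ Reach G .up .left (a, l) (z.1, d) ∧ Reach G .up .left (z.1, d) m)

variable {a l h : ℤ} {m z : ℤ × ℤ}

lemma Pocket.mem_box (hz : Pocket G a l h m z) : z ∈ Set.Icc (m.1, l) (a, m.2) := by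
  obtain ⟨ha, ⟨d, hd, h1, h2⟩, ⟨d', hd', h3, h4⟩⟩ := hz
  have h5 := h2.nw_le
  have h6 := h3.nw_le
  simp only at h5 h6
  simp only [Set.mem_Icc, Prod.le_def]
  omega

lemma pocket_of_lt (hl : l < z.2) (hh : z.2 < h) (hz : z.1 = a)
    (h1 : Reach G .up .left (a, l) m) (h2 : Reach G .up .left (a, h) m) : Pocket G a l h m z :=
  ⟨hz.le, ⟨h, hh, by rw [hz]; exact .refl, by rwa [hz]⟩, ⟨l, hl, by rw [hz]; exact .refl, by rwa [hz]⟩⟩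

lemma Pocket.lt_of_eq (hz : Pocket G a l h m z) (hne : ¬ Reach G .up .left (a, h) z)
    (ha : z.1 = a) : l < z.2 ∧ z.2 < h := by
  obtain ⟨-, ⟨d, hd, h1, -⟩, ⟨d', hd', h3, -⟩⟩ := hz
  have h5 := h3.nw_le
  simp only at h5
  refine ⟨by omega, ?_⟩
  by_contra! hle
  rcases h1.nw_visits_or ha.symm hle with h | h | ⟨e, -, -, h⟩
  · exact hne h
  · simp only at h; omega
  · have := h.nw_le; simp only at this; omega

/-- A nearest-neighbour step that avoids both paths and stays west of column `a` does not leave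
the pocket. -/
lemma Pocket.step (hz : Pocket G a l h m z) (e : Dir) (hl : ¬ Reach G .up .left (a, l) z)
    (hh : ¬ Reach G .up .left (a, h) z) (hl' : ¬ Reach G .up .left (a, l) (z + e.vec))
    (hh' : ¬ Reach G .up .left (a, h) (z + e.vec)) (ha : (z + e.vec).1 ≤ a) :
    Pocket G a l h m (z + e.vec) := by
  obtain ⟨c, d⟩ := z
  obtain ⟨-, ⟨t, ht, t1, t2⟩, ⟨s, hs, s1, s2⟩⟩ := hz
  simp only at ht t1 t2 hs s1 s2
  cases e
  · -- west
    rw [show ((c, d) : ℤ × ℤ) + Dir.left.vec = (c - 1, d) by simp [Dir.vec]; rfl] at *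
    have htm := t2.nw_le
    simp only at htm
    rcases s2.nw_visits_or (d := d) rfl hs.le with h | h | ⟨e, he, h1, h2⟩
    · exact absurd (s1.trans h) hl
    · omega
    · have hem := h2.nw_le
      simp only at hem
      obtain ⟨e', he', h3, h4⟩ := t2.nw_exists_left rfl (by omega)
      exact ⟨ha, ⟨e', by simp only at he' ⊢; omega, t1.trans h3, h4⟩, ⟨e, he, s1.trans h1, h2⟩⟩
  · -- east
    rw [show ((c, d) : ℤ × ℤ) + Dir.right.vec = (c + 1, d) by simp [Dir.vec]] at *
    simp only at ha
    obtain ⟨e, he, h1, h2, h3⟩ := t1.nw_exists_right rfl (by simp only; omega)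
    obtain ⟨e', he', h1', h2', h3'⟩ := s1.nw_exists_right rfl (by simp only; omega)
    simp only at he he'
    refine ⟨ha, ⟨e, ?_, h1, h2.trans (h3.trans t2)⟩, ⟨e', by simp only; omega, h1',
      h2'.trans (h3'.trans s2)⟩⟩
    simp only
    by_contra! hle
    rcases h3.nw_visits_or rfl hle with h | h | ⟨e'', -, -, h⟩
    · exact hh (h1.trans (h2.trans h))
    · simp only at h; omega
    · have := h.nw_le; simp only at this; omega
  · -- north
    rw [show ((c, d) : ℤ × ℤ) + Dir.up.vec = (c, d + 1) by simp [Dir.vec]] at *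
    have : t ≠ d + 1 := by rintro rfl; exact hh' t1
    exact ⟨ha, ⟨t, by simp only; omega, t1, t2⟩, ⟨s, by simp only; omega, s1, s2⟩⟩
  · -- south
    rw [show ((c, d) : ℤ × ℤ) + Dir.down.vec = (c, d - 1) by simp [Dir.vec]; rfl] at *
    have : s ≠ d - 1 := by rintro rfl; exact hl' s1
    exact ⟨ha, ⟨t, by simp only; omega, t1, t2⟩, ⟨s, by simp only; omega, s1, s2⟩⟩

end NorthWest

lemma fwdCluster_subset_filledCluster (G : Env) (x : ℤ × ℤ) : fwdCluster G x ⊆ filledCluster G x :=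
  fun _ hz _ _ h0 => ⟨0, by rw [h0]; exact hz⟩

/-- Of two points of the cluster in one column, the north-west paths meet and so do the
south-east paths. These four paths confine everything that lies between the two points. -/
theorem Good.mem_filledCluster {G : Env} (hG : Good G) {x : ℤ × ℤ} {a l h b : ℤ}
    (hl : Connected G x (a, l)) (hh : Connected G x (a, h)) (hlb : l ≤ b) (hbh : b ≤ h) :
    (a, b) ∈ filledCluster G x := by
  intro γ hγ h0
  by_contra! havoid
  obtain ⟨m, hm1, hm2⟩ := hG.nw_meet a l h
  obtain ⟨m', hm1', hm2'⟩ := hG.rot.nw_meet (-a) (-h) (-l)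
  have hlt : l < b := hlb.lt_of_ne (by rintro rfl; exact havoid 0 (by rw [h0]; exact hl))
  have hlt' : b < h := hbh.lt_of_ne (by rintro rfl; exact havoid 0 (by rw [h0]; exact hh))
  have av : ∀ n c, Connected G x (a, c) → ¬ Reach G .up .left (a, c) (γ n) := fun n c hc hr =>
    havoid n (hc.trans hr.connected)
  have av' : ∀ n c, Connected G x (a, c) → ¬ Reach (rot G) .up .left (-a, -c) (-γ n) :=
    fun n c hc hr => havoid n (Relation.ReflTransGen.trans hc (by
      simpa [Connected] using connected_rot.1 hr.connected))
  -- the path changes from one pocket to the other only in column `a`, strictly between `l` and `h`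
  have hinv : ∀ n, Pocket G a l h m (γ n) ∨ Pocket (rot G) (-a) (-h) (-l) m' (-γ n) := by
    intro n
    induction n with
    | zero =>
      left
      rw [h0]
      exact pocket_of_lt hlt hlt' rfl hm1 hm2
    | succ n ih =>
      obtain ⟨e, he⟩ := hγ.1 n
      have he' : -γ (n + 1) = -γ n + e.neg.vec := by rw [he, Dir.vec_neg, neg_add]
      have hL : (γ (n + 1)).1 ≤ a → Pocket G a l h m (γ n) → Pocket G a l h m (γ (n + 1)) := by
        intro hle hp
        rw [he] at hle ⊢
        exact hp.step e (av n l hl) (av n h hh) (he ▸ av (n + 1) l hl) (he ▸ av (n + 1) h hh) hle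
      have hR : a ≤ (γ (n + 1)).1 → Pocket (rot G) (-a) (-h) (-l) m' (-γ n) →
          Pocket (rot G) (-a) (-h) (-l) m' (-γ (n + 1)) := by
        intro hle hp
        have hle' : (-γ (n + 1)).1 ≤ -a := by simpa using hle
        rw [he'] at hle' ⊢
        exact hp.step e.neg (av' n h hh) (av' n l hl) (he' ▸ av' (n + 1) h hh)
          (he' ▸ av' (n + 1) l hl) hle'
      have hstep : (γ (n + 1)).1 ≤ (γ n).1 + 1 ∧ (γ n).1 - 1 ≤ (γ (n + 1)).1 := by
        rw [he]; cases e <;> (simp [Dir.vec]; try omega)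
      rcases ih with hp | hp
      · by_cases hle : (γ (n + 1)).1 ≤ a
        · exact Or.inl (hL hle hp)
        · have hca : (γ n).1 = a := by have := hp.1; omega
          have hb := hp.lt_of_eq (av n h hh) hca
          exact Or.inr (hR (by omega) (pocket_of_lt (by simp; omega) (by simp; omega)
            (by simp [hca]) hm1' hm2'))
      · by_cases hle : a ≤ (γ (n + 1)).1
        · exact Or.inr (hR hle hp)
        · have hca : (γ n).1 = a := by have := hp.1; simp at this; omega
          have hb := hp.lt_of_eq (av' n l hl) (by simp [hca])
          simp at hb
          exact Or.inl (hL (by omega) (pocket_of_lt (by omega) (by omega) hca hm1 hm2))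
  -- a self-avoiding path cannot stay in the finitely many sites of the two pockets
  have hfin : (Set.Icc (m.1, l) (a, m.2) ∪
      (fun z : ℤ × ℤ => -z) ⁻¹' Set.Icc (m'.1, -h) (-a, m'.2)).Finite :=
    (Set.finite_Icc _ _).union ((Set.finite_Icc _ _).preimage neg_injective.injOn)
  refine Set.infinite_range_of_injective hγ.2 (hfin.subset ?_)
  rintro _ ⟨n, rfl⟩
  exact (hinv n).imp (fun hp => hp.mem_box) (fun hp => hp.mem_box)

/-! ### The shape of the filled cluster -/

/-- The forward cluster of `x` is bounded below in the column of `x`. -/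
def LowerBdd (G : Env) (x : ℤ × ℤ) : Prop := ∃ B, ∀ b, Connected G x (x.1, b) → B ≤ b

/-- The forward cluster of `x` is bounded above in the column of `x`. -/
def UpperBdd (G : Env) (x : ℤ × ℤ) : Prop := ∃ B, ∀ b, Connected G x (x.1, b) → b ≤ B

lemma lowerBdd_rot_neg {G : Env} {x : ℤ × ℤ} : LowerBdd (rot G) (-x) ↔ UpperBdd G x := by
  constructor
  · rintro ⟨B, hB⟩
    refine ⟨-B, fun b hb => ?_⟩
    have := hB (-b) (connected_rot.2 (by simpa using hb))
    omega
  · rintro ⟨B, hB⟩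
    refine ⟨-B, fun b hb => ?_⟩
    have := hB (-b) (by simpa using connected_rot.1 hb)
    omega

lemma upperBdd_rot_neg {G : Env} {x : ℤ × ℤ} : UpperBdd (rot G) (-x) ↔ LowerBdd G x := by
  rw [← lowerBdd_rot_neg, rot_rot, neg_neg]

section Columns

variable {G : Env}

/-- Going north-west from `(c, d)`, and west where possible, one cannot climb over a row that is
open to the west. -/
lemma Good.exists_west_of_row (hG : Good G) {a b c d : ℤ} (hac : a ≤ c) (hdb : d ≤ b)
    (hrow : ∀ c', a ≤ c' → c' ≤ c → Dir.left ∈ G (c', b)) :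
    ∃ t, d ≤ t ∧ t ≤ b ∧ Connected G (c, d) (a, t) := by
  obtain ⟨n, hn⟩ : ∃ n : ℕ, (c - a) + (b - d) = n := ⟨_, (Int.toNat_of_nonneg (by omega)).symm⟩
  induction n generalizing c d with
  | zero => exact ⟨d, le_rfl, hdb, by rw [show c = a by omega]; exact .refl⟩
  | succ n ih =>
    rcases hac.eq_or_lt with rfl | hac
    · exact ⟨d, le_rfl, hdb, .refl⟩
    by_cases hleft : Dir.left ∈ G (c, d)
    · obtain ⟨t, h1, h2, h3⟩ := ih (c := c - 1) (d := d) (by omega) hdb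
        (fun c' h1 h2 => hrow c' h1 (by omega)) (by omega)
      exact ⟨t, h1, h2, h3.head ⟨_, hleft, by simp [Dir.vec]; rfl⟩⟩
    · have hup := (hG.nw (c, d)).resolve_right hleft
      have hne : d ≠ b := by rintro rfl; exact hleft (hrow c hac.le le_rfl)
      obtain ⟨t, h1, h2, h3⟩ := ih (c := c) (d := d + 1) hac.le (by omega) hrow (by omega)
      exact ⟨t, by omega, h2, h3.head ⟨_, hup, by simp [Dir.vec]⟩⟩

lemma Good.exists_west (hG : Good G) {a c : ℤ} (hac : a ≤ c) (d : ℤ) :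
    ∃ t, d ≤ t ∧ Connected G (c, d) (a, t) := by
  obtain ⟨b, hb, hrow⟩ := hG.row_above .left a c d
  obtain ⟨t, h1, -, h3⟩ := hG.exists_west_of_row hac hb hrow
  exact ⟨t, h1, h3⟩

lemma Good.exists_east (hG : Good G) {a c : ℤ} (hac : c ≤ a) (d : ℤ) :
    ∃ t, t ≤ d ∧ Connected G (c, d) (a, t) := by
  obtain ⟨t, h1, h2⟩ := hG.rot.exists_west (neg_le_neg hac) (-d)
  exact ⟨-t, by omega, by simpa using connected_rot.1 h2⟩

lemma Good.exists_connected (hG : Good G) (x : ℤ × ℤ) (a : ℤ) : ∃ b, Connected G x (a, b) := by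
  rcases le_total a x.1 with h | h
  · obtain ⟨t, -, ht⟩ := hG.exists_west h x.2; exact ⟨t, ht⟩
  · obtain ⟨t, -, ht⟩ := hG.exists_east h x.2; exact ⟨t, ht⟩

/-- A cluster bounded below in one column is bounded below in every column. To the east of the
given column this uses a low row that is open to the west: from below this row, a path leads back
to the given column at a height below its bound. -/
lemma Good.exists_lower_bound (hG : Good G) {x : ℤ × ℤ} {a B : ℤ}
    (hB : ∀ b, Connected G x (a, b) → B ≤ b) (c : ℤ) :
    ∃ B', ∀ b, Connected G x (c, b) → B' ≤ b := by
  rcases le_total c a with hca | hac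
  · refine ⟨B, fun b hb => ?_⟩
    obtain ⟨t, ht, h⟩ := hG.exists_east hca b
    exact (hB t (hb.trans h)).trans ht
  · obtain ⟨r, hr, hrow⟩ := hG.row_below .left a c (B - 1)
    refine ⟨r, fun b hb => ?_⟩
    by_contra! hlt
    obtain ⟨t, -, ht, h⟩ := hG.exists_west_of_row hac hlt.le hrow
    have := hB t (hb.trans h)
    omega

lemma Good.exists_above (hG : Good G) {x : ℤ × ℤ} (hx : ¬ UpperBdd G x) (a B : ℤ) :
    ∃ b, B ≤ b ∧ Connected G x (a, b) := by
  by_contra! h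
  obtain ⟨B', hB'⟩ := hG.rot.exists_lower_bound (x := -x) (a := -a) (B := -B) (fun b hb => by
    by_contra! hlt
    exact h (-b) (by omega) (by simpa using connected_rot.1 hb)) (-x).1
  exact hx (lowerBdd_rot_neg.1 ⟨B', hB'⟩)

lemma Good.exists_below (hG : Good G) {x : ℤ × ℤ} (hx : ¬ LowerBdd G x) (a B : ℤ) :
    ∃ b, b ≤ B ∧ Connected G x (a, b) := by
  obtain ⟨b, hb, h⟩ := hG.rot.exists_above (mt upperBdd_rot_neg.1 hx) (-a) (-B)
  exact ⟨-b, by omega, by simpa using connected_rot.1 h⟩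

theorem Good.isFull (hG : Good G) {x : ℤ × ℤ} (hL : ¬ LowerBdd G x) (hU : ¬ UpperBdd G x) :
    IsFull G x := by
  refine Set.eq_univ_of_forall fun z => ?_
  obtain ⟨l, hl, h1⟩ := hG.exists_below hL z.1 z.2
  obtain ⟨h, hh, h2⟩ := hG.exists_above hU z.1 z.2
  exact hG.mem_filledCluster h1 h2 hl hh

/-- The lower boundary of a cluster that is bounded below. -/
lemma Good.exists_lower_boundary (hG : Good G) {x : ℤ × ℤ} (hL : LowerBdd G x) :
    ∃ W : ℤ → ℤ, (∀ a, Connected G x (a, W a)) ∧ ∀ a b, Connected G x (a, b) → W a ≤ b := by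
  obtain ⟨B, hB⟩ := hL
  have : ∀ a, ∃ w, Connected G x (a, w) ∧ ∀ b, Connected G x (a, b) → w ≤ b := fun a =>
    Int.exists_least_of_bdd (hG.exists_lower_bound hB a) (hG.exists_connected x a)
  choose W h1 h2 using this
  exact ⟨W, h1, h2⟩

lemma Good.antitone_lower_boundary (hG : Good G) {x : ℤ × ℤ} {W : ℤ → ℤ}
    (h1 : ∀ a, Connected G x (a, W a)) (h2 : ∀ a b, Connected G x (a, b) → W a ≤ b) :
    Antitone W := by
  intro a a' haa
  obtain ⟨t, ht, h⟩ := hG.exists_east haa (W a)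
  exact (h2 a' t ((h1 a).trans h)).trans ht

/-- A path from the cluster side could only cross the lower boundary out of a site of the cluster:
where the boundary jumps, the steps west are closed along it, so the cluster climbs. -/
lemma Good.isFLBF_lower_boundary (hG : Good G) {x : ℤ × ℤ} {W : ℤ → ℤ}
    (h1 : ∀ a, Connected G x (a, W a)) (h2 : ∀ a b, Connected G x (a, b) → W a ≤ b) :
    IsFLBF G W := by
  have hanti := hG.antitone_lower_boundary h1 h2
  have hleft : ∀ {a b : ℤ}, Connected G x (a, b) → Dir.left ∈ G (a, b) → W (a - 1) ≤ b :=
    fun h hl => h2 _ _ (h.tail ⟨_, hl, by simp [Dir.vec]; rfl⟩)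
  have hjump : ∀ a b : ℤ, W a ≤ b → b < W (a - 1) → Connected G x (a, b) := by
    intro a b hab
    induction b, hab using Int.leInduction with
    | base => exact fun _ => h1 a
    | succ b hab ih =>
      intro hb
      have hc := ih (by omega)
      have hup := (hG.nw (a, b)).resolve_right fun hl => by have := hleft hc hl; omega
      exact hc.tail ⟨_, hup, by simp [Dir.vec]⟩
  intro y hy z hz hyz
  suffices hz' : z ∈ setGE W from not_lt.2 (show W z.1 ≤ z.2 from hz') hz
  clear hz
  induction hyz with
  | refl => exact hy
  | @tail u w _ hs ih =>
    obtain ⟨e, he, rfl⟩ := hs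
    obtain ⟨a, b⟩ := u
    replace ih : W a ≤ b := ih
    change W ((a, b) + e.vec).1 ≤ ((a, b) + e.vec).2
    cases e
    · simp only [Dir.vec, Prod.mk_add_mk, add_zero, ← sub_eq_add_neg]
      by_contra! hlt
      exact absurd (hleft (hjump a b ih hlt) he) (not_le.2 hlt)
    · simpa [Dir.vec] using (hanti (by omega : a ≤ a + 1)).trans ih
    · simp [Dir.vec]; omega
    · rcases ih.eq_or_lt with rfl | hlt
      · have := h2 a (W a - 1) ((h1 a).tail ⟨_, he, by simp [Dir.vec]; rfl⟩)
        omega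
      · simp [Dir.vec]; omega

theorem Good.isBlockedBelow (hG : Good G) {x : ℤ × ℤ} (hL : LowerBdd G x) (hU : ¬ UpperBdd G x) :
    IsBlockedBelow G x := by
  obtain ⟨W, h1, h2⟩ := hG.exists_lower_boundary hL
  refine ⟨W, hG.antitone_lower_boundary h1 h2, hG.isFLBF_lower_boundary h1 h2, ?_⟩
  ext z
  constructor
  · intro hz
    by_contra hlt
    -- below the boundary, the path straight down avoids the cluster
    obtain ⟨n, hn⟩ := hz (fun n => (z.1, z.2 - n)) ⟨fun n => ⟨.down, by simp [Dir.vec]; ring⟩,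
      fun m n h => by simpa using h⟩ (by simp)
    have := h2 _ _ hn
    simp only [setGE, mem_ofPred_eq] at hlt
    omega
  · intro hz
    obtain ⟨h, hh, hc⟩ := hG.exists_above hU z.1 z.2
    exact hG.mem_filledCluster (h1 z.1) hc hz hh

lemma IsBlockedBelow.lowerBdd {x : ℤ × ℤ} (h : IsBlockedBelow G x) : LowerBdd G x := by
  obtain ⟨W, -, -, hW⟩ := h
  refine ⟨W x.1, fun b hb => ?_⟩
  have : (x.1, b) ∈ setGE W := hW ▸ fwdCluster_subset_filledCluster G x hb
  exact this

lemma IsBlockedBelow.not_isFull {x : ℤ × ℤ} (h : IsBlockedBelow G x) : ¬ IsFull G x := by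
  obtain ⟨W, -, -, hW⟩ := h
  intro hfull
  have : ((0, W 0 - 1) : ℤ × ℤ) ∈ setGE W := by rw [← hW, hfull]; trivial
  simp [setGE] at this

/-- A lower bound passes from a cluster to those that start higher, which the lower boundary
confines as well. -/
lemma Good.lowerBdd_up (hG : Good G) {x : ℤ × ℤ} (hL : LowerBdd G x) :
    LowerBdd G (x + Dir.up.vec) := by
  obtain ⟨W, h1, h2⟩ := hG.exists_lower_boundary hL
  refine ⟨W x.1, fun b hb => ?_⟩
  by_contra! hlt
  have hx : W x.1 ≤ x.2 := h2 _ _ .refl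
  exact hG.isFLBF_lower_boundary h1 h2 _ (by simp [setGE, Dir.vec]; omega) _
    (by simpa [setLT, Dir.vec] using hlt) hb

lemma neg_mem_filledCluster_rot {x z : ℤ × ℤ} (h : z ∈ filledCluster G x) :
    -z ∈ filledCluster (rot G) (-x) := by
  intro γ hγ h0
  have hγ' : IsSelfAvoidingPath fun n => -γ n := by
    refine ⟨fun n => ?_, fun i j hij => hγ.2 (neg_injective hij)⟩
    obtain ⟨e, he⟩ := hγ.1 n
    exact ⟨e.neg, by simp only [he, Dir.vec_neg, neg_add]⟩
  obtain ⟨n, hn⟩ := h _ hγ' (by simp [h0])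
  exact ⟨n, connected_rot.2 (by rw [neg_neg]; exact hn)⟩

lemma mem_filledCluster_iff_rot {x z : ℤ × ℤ} :
    z ∈ filledCluster G x ↔ -z ∈ filledCluster (rot G) (-x) :=
  ⟨neg_mem_filledCluster_rot, fun h => by
    simpa [rot_rot] using neg_mem_filledCluster_rot h⟩

lemma isBlockedBelow_rot_neg {x : ℤ × ℤ} : IsBlockedBelow (rot G) (-x) ↔ IsBlockedAbove G x := by
  constructor
  · rintro ⟨W, hW, hb, hf⟩
    refine ⟨fun a => -W (-a), fun a a' h => neg_le_neg (hW (neg_le_neg h)), ?_, ?_⟩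
    · intro y hy z hz hyz
      simp only [setLE, setGT, mem_ofPred_eq] at hy hz
      refine hb (-y) ?_ (-z) ?_ (connected_rot_neg hyz)
      · simp [setGE]; omega
      · simp [setLT]; omega
    · ext z
      rw [mem_filledCluster_iff_rot, hf]
      simp [setGE, setLE]; omega
  · rintro ⟨W, hW, hb, hf⟩
    refine ⟨fun a => -W (-a), fun a a' h => neg_le_neg (hW (neg_le_neg h)), ?_, ?_⟩
    · intro y hy z hz hyz
      simp only [setGE, setLT, mem_ofPred_eq] at hy hz
      refine hb (-y) ?_ (-z) ?_ (connected_rot.1 hyz)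
      · simp [setLE]; omega
      · simp [setGT]; omega
    · ext z
      rw [mem_filledCluster_iff_rot, rot_rot, neg_neg, hf]
      simp [setGE, setLE]; omega

lemma isFull_rot_neg {x : ℤ × ℤ} : IsFull (rot G) (-x) ↔ IsFull G x := by
  simp only [IsFull, Set.eq_univ_iff_forall]
  constructor
  · intro h z; exact mem_filledCluster_iff_rot.2 (h (-z))
  · intro h z; simpa using mem_filledCluster_iff_rot.1 (h (-z))

theorem Good.isBlockedAbove (hG : Good G) {x : ℤ × ℤ} (hL : ¬ LowerBdd G x) (hU : UpperBdd G x) :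
    IsBlockedAbove G x :=
  isBlockedBelow_rot_neg.1 (hG.rot.isBlockedBelow (lowerBdd_rot_neg.2 hU)
    (mt upperBdd_rot_neg.1 hL))

lemma IsBlockedAbove.upperBdd {x : ℤ × ℤ} (h : IsBlockedAbove G x) : UpperBdd G x :=
  lowerBdd_rot_neg.1 (isBlockedBelow_rot_neg.2 h).lowerBdd

lemma IsBlockedAbove.not_isFull {x : ℤ × ℤ} (h : IsBlockedAbove G x) : ¬ IsFull G x :=
  mt isFull_rot_neg.2 (isBlockedBelow_rot_neg.2 h).not_isFull

lemma Good.upperBdd_down (hG : Good G) {x : ℤ × ℤ} (hU : UpperBdd G x) :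
    UpperBdd G (x + Dir.down.vec) := by
  have := hG.rot.lowerBdd_up (lowerBdd_rot_neg.2 hU)
  rwa [show -x + Dir.up.vec = -(x + Dir.down.vec) by rw [neg_add, ← Dir.vec_neg]; rfl,
    lowerBdd_rot_neg] at this

end Columns

/-! ### Almost every environment is good -/

section AlmostSure

variable (μ : Measure (Set Dir)) [IsProbabilityMeasure μ]

lemma ae_forall_mem_of_eq_one {B : Set (Set Dir)} (hB : μ B = 1) :
    ∀ᵐ G ∂law μ, ∀ x, G x ∈ B := by
  refine ae_all_iff.2 fun x => ?_
  have hm : MeasurableSet {G : Env | G x ∈ B} :=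
    siteAlgebra_le _ _ (measurableSet_siteAlgebra (mem_univ x) B)
  exact (prob_compl_eq_zero_iff hm).2 ((law_site μ x B).trans hB)

lemma reach_iterate_walk {G : Env} {e f : Dir} (hG : ∀ x, e ∈ G x ∨ f ∈ G x) (j : ℕ) (x : ℤ × ℤ) :
    Reach G e f x ((walk e f G)^[j] x) := by
  induction j with
  | zero => exact .refl
  | succ j ih =>
    rw [Function.iterate_succ_apply']
    refine ih.tail ?_
    by_cases h : e ∈ G ((walk e f G)^[j] x)
    · exact Or.inl ⟨h, walk_of_mem h⟩
    · exact Or.inr ⟨(hG _).resolve_left h, walk_of_notMem h⟩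

/-- After `j` steps the walk from `x` is on the level of `x + j • e.vec`. -/
lemma exists_iterate_walk_eq (G : Env) (e f : Dir) (j : ℕ) (x : ℤ × ℤ) :
    ∃ k : ℕ, x + j • e.vec = (walk e f G)^[j] x + k • (e.vec - f.vec) := by
  induction j with
  | zero => exact ⟨0, by simp⟩
  | succ j ih =>
    obtain ⟨k, hk⟩ := ih
    rw [Function.iterate_succ_apply']
    by_cases h : e ∈ G ((walk e f G)^[j] x)
    · exact ⟨k, by rw [walk_of_mem h, succ_nsmul, ← add_assoc, hk]; abel⟩
    · exact ⟨k + 1, by rw [walk_of_notMem h, succ_nsmul, ← add_assoc, hk, succ_nsmul]; abel⟩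

/-- Two paths in the directions `e`, `f` from sites on a common line of direction `e` can be made
to meet: the walk from the first site is run until it is on the level of the second one. -/
theorem ae_exists_reach_of_reach {e f : Dir} {ℓ : ℤ × ℤ →+ ℤ} (he : ℓ e.vec = 1)
    (hf : ℓ f.vec = 1) (hef : e ≠ f) (hpos : 0 < μ (meets {e})) (h1 : μ (meets {e, f}) = 1) :
    ∀ᵐ G ∂law μ, ∀ (x : ℤ × ℤ) (n : ℕ),
      ∃ m, Reach G e f x m ∧ Reach G e f (x + n • e.vec) m := by
  rw [meets_singleton] at hpos
  by_cases hp1 : μ {E | e ∈ E} = 1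
  -- if `e` is always available the walks do not coalesce, but one site reaches the other directly
  · filter_upwards [ae_forall_mem_of_eq_one μ hp1] with G hG x n
    refine ⟨_, ?_, .refl⟩
    induction n with
    | zero => rw [zero_nsmul, add_zero]; exact .refl
    | succ n ih => exact ih.tail (Or.inl ⟨hG _, by rw [succ_nsmul, add_assoc]⟩)
  · have hmeet : ∀ᵐ G ∂law μ, ∀ (x : ℤ × ℤ) (k : ℕ),
        G ∉ NeverMeet e f x (x + k • (e.vec - f.vec)) := by
      refine ae_all_iff.2 fun x => ae_all_iff.2 fun k => measure_eq_zero_iff_ae_notMem.1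
        (law_neverMeet_eq_zero μ he hf hef ?_ ?_ x k)
      · exact fun h => hpos.ne' ((measureReal_eq_zero_iff).1 h)
      · exact fun h => hp1 ((ENNReal.toReal_eq_one_iff _).1 h)
    filter_upwards [ae_forall_mem_of_eq_one μ h1, hmeet] with G hG hm x n
    have hG' : ∀ x, e ∈ G x ∨ f ∈ G x := by
      intro x
      obtain ⟨g, hg, rfl | rfl⟩ := hG x
      · exact Or.inl hg
      · exact Or.inr hg
    obtain ⟨k, hk⟩ := exists_iterate_walk_eq G e f n x
    have hj := hm ((walk e f G)^[n] x) k
    simp only [NeverMeet, mem_ofPred_eq, not_forall, not_not] at hj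
    obtain ⟨j, hj⟩ := hj
    rw [← hk] at hj
    exact ⟨_, (reach_iterate_walk hG' n x).trans (reach_iterate_walk hG' j _),
      hj ▸ reach_iterate_walk hG' j _⟩

theorem ae_good (hNW : μ (meets {Dir.left, Dir.up}) = 1) (hSE : μ (meets {Dir.right, Dir.down}) = 1)
    (hpos : ∀ e, 0 < μ (meets {e})) : ∀ᵐ G ∂law μ, Good G := by
  have hrow : ∀ v : ℤ × ℤ, v ≠ 0 → ∀ᵐ G ∂law μ, ∀ (e : Dir) (a a' N : ℤ),
      ∃ n : ℕ, ∀ x ∈ (Finset.Icc a a').image (fun c => (c, N)), e ∈ G (x + n • v) :=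
    fun v hv => ae_all_iff.2 fun e => ae_all_iff.2 fun a => ae_all_iff.2 fun a' =>
      ae_all_iff.2 fun N => ae_exists_translate_forall_mem μ (hpos e) hv _
  have hnw := ae_exists_reach_of_reach μ (e := .up) (f := .left)
    (ℓ := AddMonoidHom.snd ℤ ℤ - AddMonoidHom.fst ℤ ℤ) (by simp [Dir.vec]) (by simp [Dir.vec])
    (by simp) (hpos _) (by rwa [pair_comm])
  have hse := ae_exists_reach_of_reach μ (e := .down) (f := .right)
    (ℓ := AddMonoidHom.fst ℤ ℤ - AddMonoidHom.snd ℤ ℤ) (by simp [Dir.vec]) (by simp [Dir.vec])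
    (by simp) (hpos _) (by rwa [pair_comm])
  filter_upwards [ae_forall_mem_of_eq_one μ hNW, ae_forall_mem_of_eq_one μ hSE,
    hrow (0, 1) (by simp), hrow (0, -1) (by simp), hnw, hse] with G g1 g2 g3 g4 g5 g6
  refine ⟨fun x => ?_, fun x => ?_, fun e a a' N => ?_, fun e a a' N => ?_, ?_, ?_⟩
  · obtain ⟨g, hg, rfl | rfl⟩ := g1 x
    · exact Or.inr hg
    · exact Or.inl hg
  · obtain ⟨g, hg, rfl | rfl⟩ := g2 x
    · exact Or.inr hg
    · exact Or.inl hg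
  · obtain ⟨n, hn⟩ := g3 e a a' N
    refine ⟨N + n, by omega, fun c h1 h2 => ?_⟩
    simpa using hn (c, N) (Finset.mem_image_of_mem _ (Finset.mem_Icc.2 ⟨h1, h2⟩))
  · obtain ⟨n, hn⟩ := g4 e a a' N
    refine ⟨N - n, by omega, fun c h1 h2 => ?_⟩
    simpa [sub_eq_add_neg] using hn (c, N) (Finset.mem_image_of_mem _ (Finset.mem_Icc.2 ⟨h1, h2⟩))
  · have key : ∀ a b b' : ℤ, b ≤ b' →
        ∃ m, Reach G .up .left (a, b) m ∧ Reach G .up .left (a, b') m := by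
      intro a b b' hb
      obtain ⟨n, hn⟩ := Int.le.dest hb
      simpa [Dir.vec, hn] using g5 (a, b) n
    intro a b b'
    rcases le_total b b' with hb | hb
    · exact key a b b' hb
    · obtain ⟨m, h1, h2⟩ := key a b' b hb
      exact ⟨m, h2, h1⟩
  · have key : ∀ a b b' : ℤ, b' ≤ b →
        ∃ m, Reach G .down .right (a, b) m ∧ Reach G .down .right (a, b') m := by
      intro a b b' hb
      obtain ⟨n, hn⟩ := Int.le.dest hb
      have hn' : b + -(n : ℤ) = b' := by omega
      simpa [Dir.vec, hn'] using g6 (a, b) n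
    intro a b b'
    rcases le_total b' b with hb | hb
    · exact key a b b' hb
    · obtain ⟨m, h1, h2⟩ := key a b' b hb
      exact ⟨m, h2, h1⟩

end AlmostSure

/-! ### Which side is bounded -/

section ZeroOne

lemma measurableSet_connected (x y : ℤ × ℤ) : MeasurableSet {G | Connected G x y} := by
  have hstep : ∀ u w : ℤ × ℤ, MeasurableSet {G | Step G u w} := by
    intro u w
    have : {G | Step G u w} = ⋃ e : Dir, {G : Env | e ∈ G u} ∩ {_G | w = u + e.vec} := by
      ext G; simp [Step]
    rw [this]
    exact MeasurableSet.iUnion fun e => (measurableSet_mem u e).inter (MeasurableSet.const _)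
  -- `R n w`: an open path of `n` steps leads from `x` to `w`
  let R : ℕ → ℤ × ℤ → Set Env := Nat.rec (fun w => {_G | w = x})
    (fun _ A w => ⋃ u, A u ∩ {G | Step G u w})
  have hR : ∀ n w, MeasurableSet (R n w) := by
    intro n
    induction n with
    | zero => exact fun w => MeasurableSet.const _
    | succ n ih => exact fun w => MeasurableSet.iUnion fun u => (ih u).inter (hstep u w)
  have : {G | Connected G x y} = ⋃ n, R n y := by
    ext G
    simp only [mem_ofPred_eq, mem_iUnion]
    constructor
    · intro h
      induction h with
      | refl => exact ⟨0, rfl⟩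
      | @tail u w _ hs ih =>
        obtain ⟨n, hn⟩ := ih
        exact ⟨n + 1, mem_iUnion.2 ⟨u, hn, hs⟩⟩
    · rintro ⟨n, hn⟩
      induction n generalizing y with
      | zero => rw [show y = x from hn]; exact .refl
      | succ n ih =>
        obtain ⟨u, h1, h2⟩ := mem_iUnion.1 hn
        exact (ih u h1).tail h2
  rw [this]
  exact MeasurableSet.iUnion fun n => hR n y

lemma measurableSet_forall_connected (x : ℤ × ℤ) (q : ℤ → Prop) :
    MeasurableSet {G | ∀ b, Connected G x (x.1, b) → q b} := by
  have : {G | ∀ b, Connected G x (x.1, b) → q b} =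
      ⋂ b, ({G | Connected G x (x.1, b)}ᶜ ∪ {_G | q b}) := by
    ext G; simp [imp_iff_not_or]
  rw [this]
  exact MeasurableSet.iInter fun b =>
    (measurableSet_connected x _).compl.union (MeasurableSet.const _)

lemma measurableSet_lowerBdd (x : ℤ × ℤ) : MeasurableSet {G | LowerBdd G x} := by
  have : {G | LowerBdd G x} = ⋃ B, {G | ∀ b, Connected G x (x.1, b) → B ≤ b} := by
    ext G; simp [LowerBdd]
  rw [this]
  exact MeasurableSet.iUnion fun B => measurableSet_forall_connected x _

lemma measurableSet_upperBdd (x : ℤ × ℤ) : MeasurableSet {G | UpperBdd G x} := by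
  have : {G | UpperBdd G x} = ⋃ B, {G | ∀ b, Connected G x (x.1, b) → b ≤ B} := by
    ext G; simp [UpperBdd]
  rw [this]
  exact MeasurableSet.iUnion fun B => measurableSet_forall_connected x _

lemma connected_shift {v : ℤ × ℤ} {G : Env} {x y : ℤ × ℤ} :
    Connected (shift v G) x y ↔ Connected G (x + v) (y + v) := by
  have key : ∀ {v : ℤ × ℤ} {G : Env} {x y : ℤ × ℤ}, Connected (shift v G) x y →
      Connected G (x + v) (y + v) := by
    intro v G x y h
    refine Relation.ReflTransGen.lift (fun z => z + v) ?_ _ _ h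
    rintro u w ⟨e, he, rfl⟩
    exact ⟨e, he, add_right_comm _ _ _⟩
  refine ⟨key, fun h => ?_⟩
  have hG : shift (-v) (shift v G) = G := by rw [shift_shift, neg_add_cancel, shift_zero]
  rw [← hG] at h
  simpa using key h

lemma lowerBdd_shift {v : ℤ × ℤ} {G : Env} {x : ℤ × ℤ} :
    LowerBdd (shift v G) x ↔ LowerBdd G (x + v) := by
  simp only [LowerBdd, connected_shift]
  constructor
  · rintro ⟨B, hB⟩
    refine ⟨B + v.2, fun b hb => ?_⟩
    have := hB (b - v.2) (by convert hb using 1; ext <;> simp)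
    omega
  · rintro ⟨B, hB⟩
    exact ⟨B - v.2, fun b hb => by have := hB (b + v.2) hb; omega⟩

lemma upperBdd_shift {v : ℤ × ℤ} {G : Env} {x : ℤ × ℤ} :
    UpperBdd (shift v G) x ↔ UpperBdd G (x + v) := by
  simp only [UpperBdd, connected_shift]
  constructor
  · rintro ⟨B, hB⟩
    refine ⟨B + v.2, fun b hb => ?_⟩
    have := hB (b - v.2) (by convert hb using 1; ext <;> simp)
    omega
  · rintro ⟨B, hB⟩
    exact ⟨B - v.2, fun b hb => by have := hB (b + v.2) hb; omega⟩

variable (μ : Measure (Set Dir)) [IsProbabilityMeasure μ]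

lemma law_lowerBdd_eq (x : ℤ × ℤ) : law μ {G | LowerBdd G x} = law μ {G | LowerBdd G 0} := by
  rw [← (measurePreserving_shift μ x).measure_preimage (measurableSet_lowerBdd 0).nullMeasurableSet]
  congr 1
  ext G
  simp [lowerBdd_shift]

lemma law_upperBdd_eq (x : ℤ × ℤ) : law μ {G | UpperBdd G x} = law μ {G | UpperBdd G 0} := by
  rw [← (measurePreserving_shift μ x).measure_preimage (measurableSet_upperBdd 0).nullMeasurableSet]
  congr 1
  ext G
  simp [upperBdd_shift]

variable {μ}

lemma law_lowerBdd_zero_or_one (hgood : ∀ᵐ G ∂law μ, Good G) (x : ℤ × ℤ) :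
    law μ {G | LowerBdd G x} = 0 ∨ law μ {G | LowerBdd G x} = 1 := by
  refine law_eq_zero_or_one μ (v := Dir.up.vec) (by simp [Dir.vec]) (measurableSet_lowerBdd x) ?_
  filter_upwards [hgood] with G hG hL
  exact lowerBdd_shift.2 (hG.lowerBdd_up hL)

lemma law_upperBdd_zero_or_one (hgood : ∀ᵐ G ∂law μ, Good G) (x : ℤ × ℤ) :
    law μ {G | UpperBdd G x} = 0 ∨ law μ {G | UpperBdd G x} = 1 := by
  refine law_eq_zero_or_one μ (v := Dir.down.vec) (by simp [Dir.vec]) (measurableSet_upperBdd x) ?_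
  filter_upwards [hgood] with G hG hU
  exact upperBdd_shift.2 (hG.upperBdd_down hU)

/-- Clusters cannot be bounded on both sides: with positive probability the cluster of the origin
and that of a site far above it would then be separated in column `0`, while both clusters have a
common site, hence a common site in column `0`. -/
theorem not_law_lowerBdd_and_upperBdd (hgood : ∀ᵐ G ∂law μ, Good G)
    (hL : law μ {G | LowerBdd G 0} = 1) (hU : law μ {G | UpperBdd G 0} = 1) : False := by
  have hhalf : ENNReal.ofReal (1 / 2) < 1 := by
    rw [← ENNReal.ofReal_one]; exact ENNReal.ofReal_lt_ofReal_iff_of_nonneg (by norm_num) |>.2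
      (by norm_num)
  have large : ∀ A : ℕ → Set Env, Monotone A → law μ (⋃ n, A n) = 1 →
      ∃ n, ENNReal.ofReal (1 / 2) < law μ (A n) := by
    intro A hA h1
    have := tendsto_measure_iUnion_atTop (μ := law μ) hA
    rw [h1] at this
    exact (this.eventually (lt_mem_nhds hhalf)).exists
  obtain ⟨K, hK⟩ := large (fun K => {G | ∀ b, Connected G 0 ((0 : ℤ × ℤ).1, b) → -(K : ℤ) ≤ b})
    (fun K K' h G hG b hb => by have := hG b hb; omega) (by
      rw [← hL]
      congr 1
      ext G
      simp only [mem_iUnion, LowerBdd, mem_ofPred_eq]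
      constructor
      · rintro ⟨K, h⟩; exact ⟨_, h⟩
      · rintro ⟨B, h⟩; exact ⟨B.natAbs, fun b hb => by have := h b hb; omega⟩)
  obtain ⟨M, hM⟩ := large (fun M => {G | ∀ b, Connected G 0 ((0 : ℤ × ℤ).1, b) → b ≤ (M : ℤ)})
    (fun M M' h G hG b hb => by have := hG b hb; omega) (by
      rw [← hU]
      congr 1
      ext G
      simp only [mem_iUnion, UpperBdd, mem_ofPred_eq]
      constructor
      · rintro ⟨K, h⟩; exact ⟨_, h⟩
      · rintro ⟨B, h⟩; exact ⟨B.natAbs, fun b hb => by have := h b hb; omega⟩)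
  set n : ℤ := M + K + 1
  set S : Set Env := {G | ∀ b, Connected G 0 ((0 : ℤ × ℤ).1, b) → b ≤ (M : ℤ)}
  set T : Set Env := {G | ∀ b, Connected G 0 ((0 : ℤ × ℤ).1, b) → -(K : ℤ) ≤ b}
  have hTm : MeasurableSet T := measurableSet_forall_connected 0 _
  set T' : Set Env := shift (0, n) ⁻¹' T
  have hT' : law μ T' = law μ T :=
    (measurePreserving_shift μ _).measure_preimage hTm.nullMeasurableSet
  have hdisj : ∀ᵐ G ∂law μ, G ∈ S → G ∈ T'ᶜ := by
    filter_upwards [hgood] with G hG hS hT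
    obtain ⟨m, h1, h2⟩ := hG.nw_meet 0 0 n
    obtain ⟨t, ht⟩ := hG.exists_connected m 0
    have hS' := hS t (h1.connected.trans ht)
    have hT' := hT (t - n) (connected_shift.2 (by
      simpa [Connected] using h2.connected.trans ht))
    omega
  have hle : law μ S ≤ 1 - law μ T := by
    have h : law μ S ≤ law μ T'ᶜ := measure_mono_ae hdisj
    rwa [prob_compl_eq_one_sub (measurable_shift _ hTm), hT'] at h
  have h1 : ENNReal.ofReal (1 / 2) + ENNReal.ofReal (1 / 2) < law μ S + law μ T :=
    ENNReal.add_lt_add hM hK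
  have h2 : law μ S + law μ T ≤ 1 := by
    calc law μ S + law μ T ≤ (1 - law μ T) + law μ T := by gcongr
      _ = 1 := tsub_add_cancel_of_le prob_le_one
  rw [← ENNReal.ofReal_add (by norm_num) (by norm_num)] at h1
  norm_num at h1
  exact absurd h2 (not_le.2 h1)

end ZeroOne

end DRE

theorem mainTheorem3 (μ : Measure (Set DRE.Dir)) [IsProbabilityMeasure μ]
    (hNW : μ (DRE.meets {DRE.Dir.left, DRE.Dir.up}) = 1)
    (hSE : μ (DRE.meets {DRE.Dir.right, DRE.Dir.down}) = 1)
    (hleft : 0 < μ (DRE.meets {DRE.Dir.left}))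
    (hright : 0 < μ (DRE.meets {DRE.Dir.right}))
    (hup : 0 < μ (DRE.meets {DRE.Dir.up}))
    (hdown : 0 < μ (DRE.meets {DRE.Dir.down})) :
    (∀ x : ℤ × ℤ, ∀ᵐ G ∂(DRE.law μ),
      DRE.IsFull G x ∨ DRE.IsBlockedBelow G x ∨ DRE.IsBlockedAbove G x) ∧
    ((∀ x : ℤ × ℤ, DRE.law μ {G | DRE.IsFull G x} ≠ 0 ∧
        DRE.law μ {G | DRE.IsBlockedBelow G x} = 0 ∧
        DRE.law μ {G | DRE.IsBlockedAbove G x} = 0) ∨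
      (∀ x : ℤ × ℤ, DRE.law μ {G | DRE.IsFull G x} = 0 ∧
        DRE.law μ {G | DRE.IsBlockedBelow G x} ≠ 0 ∧
        DRE.law μ {G | DRE.IsBlockedAbove G x} = 0) ∨
      (∀ x : ℤ × ℤ, DRE.law μ {G | DRE.IsFull G x} = 0 ∧
        DRE.law μ {G | DRE.IsBlockedBelow G x} = 0 ∧
        DRE.law μ {G | DRE.IsBlockedAbove G x} ≠ 0)) := by
  have hgood : ∀ᵐ G ∂DRE.law μ, DRE.Good G :=
    DRE.ae_good μ hNW hSE fun e => by cases e <;> assumption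
  have ae_of_one : ∀ {A : Set DRE.Env}, MeasurableSet A → DRE.law μ A = 1 →
      ∀ᵐ G ∂DRE.law μ, G ∈ A := fun hA h => (prob_compl_eq_zero_iff hA).2 h
  have ne_zero_of_ae : ∀ {p : DRE.Env → Prop}, (∀ᵐ G ∂DRE.law μ, p G) →
      DRE.law μ {G | p G} ≠ 0 := by
    intro p hp h0
    obtain ⟨G, h1, h2⟩ := (hp.and (measure_eq_zero_iff_ae_notMem.1 h0)).exists
    exact h2 h1
  have zero_of_ae : ∀ {p : DRE.Env → Prop}, (∀ᵐ G ∂DRE.law μ, ¬ p G) →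
      DRE.law μ {G | p G} = 0 := fun hp => measure_eq_zero_iff_ae_notMem.2 hp
  rcases DRE.law_lowerBdd_zero_or_one hgood 0 with hL | hL <;>
    rcases DRE.law_upperBdd_zero_or_one hgood 0 with hU | hU
  · have hfull : ∀ x, ∀ᵐ G ∂DRE.law μ, ¬ DRE.LowerBdd G x ∧ ¬ DRE.UpperBdd G x ∧
        DRE.IsFull G x := by
      intro x
      filter_upwards [hgood, measure_eq_zero_iff_ae_notMem.1 ((DRE.law_lowerBdd_eq μ x).trans hL),
        measure_eq_zero_iff_ae_notMem.1 ((DRE.law_upperBdd_eq μ x).trans hU)] with G hG h1 h2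
      exact ⟨h1, h2, hG.isFull h1 h2⟩
    refine ⟨fun x => (hfull x).mono fun G h => Or.inl h.2.2, Or.inl fun x => ⟨?_, ?_, ?_⟩⟩
    · exact ne_zero_of_ae ((hfull x).mono fun G h => h.2.2)
    · exact zero_of_ae ((hfull x).mono fun G h hb => h.1 hb.lowerBdd)
    · exact zero_of_ae ((hfull x).mono fun G h hb => h.2.1 hb.upperBdd)
  · have habove : ∀ x, ∀ᵐ G ∂DRE.law μ, ¬ DRE.LowerBdd G x ∧ DRE.IsBlockedAbove G x := by
      intro x
      filter_upwards [hgood, measure_eq_zero_iff_ae_notMem.1 ((DRE.law_lowerBdd_eq μ x).trans hL),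
        ae_of_one (DRE.measurableSet_upperBdd x) ((DRE.law_upperBdd_eq μ x).trans hU)]
        with G hG h1 h2
      exact ⟨h1, hG.isBlockedAbove h1 h2⟩
    refine ⟨fun x => (habove x).mono fun G h => Or.inr (Or.inr h.2),
      Or.inr (Or.inr fun x => ⟨?_, ?_, ?_⟩)⟩
    · exact zero_of_ae ((habove x).mono fun G h => h.2.not_isFull)
    · exact zero_of_ae ((habove x).mono fun G h hb => h.1 hb.lowerBdd)
    · exact ne_zero_of_ae ((habove x).mono fun G h => h.2)
  · have hbelow : ∀ x, ∀ᵐ G ∂DRE.law μ, ¬ DRE.UpperBdd G x ∧ DRE.IsBlockedBelow G x := by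
      intro x
      filter_upwards [hgood, ae_of_one (DRE.measurableSet_lowerBdd x)
        ((DRE.law_lowerBdd_eq μ x).trans hL),
        measure_eq_zero_iff_ae_notMem.1 ((DRE.law_upperBdd_eq μ x).trans hU)] with G hG h1 h2
      exact ⟨h2, hG.isBlockedBelow h1 h2⟩
    refine ⟨fun x => (hbelow x).mono fun G h => Or.inr (Or.inl h.2),
      Or.inr (Or.inl fun x => ⟨?_, ?_, ?_⟩)⟩
    · exact zero_of_ae ((hbelow x).mono fun G h => h.2.not_isFull)
    · exact ne_zero_of_ae ((hbelow x).mono fun G h => h.2)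
    · exact zero_of_ae ((hbelow x).mono fun G h hb => h.1 hb.upperBdd)
  · exact (DRE.not_law_lowerBdd_and_upperBdd hgood hL hU).elim
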